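/- Let $p\ge 1$ and let $q$ be an integer coprime to $p$. Let $L(p,q)$ be the quotient of $S^3\subset\mathbb C^2$ by $(u_1,u_2)\sim(\omega u_1,\omega^q u_2)$, $\omega=e^{2\pi i/p}$, with its Heegaard torus $T=\{|u_1|=|u_2|\}$; write a point of $T$ as $(\theta_1,\theta_2)$ for the class of $\frac1{\sqrt2}(e^{2\pi i\theta_2/p},e^{2\pi i\theta_1/p})$, so that $T=\mathbb R^2/\big((\theta_1,\theta_2)\sim(\theta_1+p,\theta_2)\sim(\theta_1+q,\theta_2+1)\big)$. The circles $\theta_2=\mathrm{const}$ bound discs in $V^\alpha=\{|u_2|\le|u_1|\}$, and the circles $\theta_1=\mathrm{const}$ bound discs in $V^\beta=\{|u_1|\le|u_2|\}$. A (toroidal) grid diagram $D$ with grid number $n$ in $L(p,q)$ consists of the $n$ rows $\frac rn<\theta_2<\frac{r+1}n$ (mod $1$) and the $n$ columns $\frac cn<\theta_1<\frac{c+1}n$ (mod $1$) of $T$, together with $n$ markings $O$ and $n$ markings $X$ in the resulting $pn^2$ parallelograms, such that each row and each column contains exactly one $O$ and exactly one $X$. The associated oriented link is obtained by joining each $O$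 to the $X$ in its column by an oriented arc in the column, each $X$ to the $O$ in its row by an oriented arc in the row, and pushing the interiors of the former arcs into $V^\beta$ and of the latter into $V^\alpha$. Its components correspond to the components of $D$; the grid number of a component is its number of columns. Links are considered up to ambient isotopy, with orientations. The homology class of an oriented knot is the $i\in\mathbb Z/p$ for which it represents $i\gamma\in H_1(L(p,q))\cong\mathbb Z/p$, where $\gamma$ is the class of the core of $V^\alpha$, oriented in the direction of increasing $\theta_2$. The lift $\widetilde D$ of $D$ is its preimage in the torus in $S^3$, a grid diagram with grid number $pn$ in $S^3=L(1,0)$. Two columns $c_1,c_2$ of $\widetilde D$ are interleaving if the rows of the two markings of $c_2$ lie in different components of the complement in the torus of the rows of the two markings of $c_1$. Let $scr(D)$ be the number of unordered interleaving pairs of columns of $\widetilde D$. Let $\mathcal I=(m_i)_{i\in\mathbb Z/p}$ be a family of non-negative integers and $n=\sum_i m_i$. Let $\mathscr D(\mathcal I)$ be the set of all grid diagrams in $L(p,q)$ all of whose components have grid number one and which have exactly $m_i$ components of homology class $i$ for each $i\in\mathbb Z/p$. Let $\sigma(l)\in\mathbb Z/p$ be defined by $\sigma(l)q\equiv l \pmod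 p$ for $0\le l\le p-1$. The trivial link diagram $D(\mathcal I)\in\mathscr D(\mathcal I)$ is the grid diagram with grid number $n$ whose markings $O_1,\dots,O_n$ lie in the parallelograms centred at $\left(\frac{2i-1}{2n},1-\frac{2i-1}{2n}\right)$, and in which, for $\sum_{k<l}m_{\sigma(k)}<i\le\sum_{k\le l}m_{\sigma(k)}$, the marking $X_i$ lies in the row and the column of $O_i$ at the end of an arc that starts at $O_i$, runs in the column in the direction of increasing $\theta_2$, and crosses the circle $\theta_2=0$ exactly $s$ times, where $0\le s\le p-1$ represents $\sigma(l)$. Let $K(\mathcal I)$ be the link associated to $D(\mathcal I)$. Lemma. For every $\mathcal I$ there is a grid diagram $\hat D(\mathcal I)\in\mathscr D(\mathcal I)$ whose associated link is isotopic to $K(\mathcal I)$ and for which $scr(\hat D(\mathcal I))$ is the minimum of $scr(\mathscr D(\mathcal I))\subset\mathbb Z_{\ge0}$. -/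

import Mathlib

open scoped Real

noncomputable section

/-! ### Lens spaces -/

/-- The unit sphere `S³ ⊂ ℂ²`. -/
def ThreeSphere : Type := {u : ℂ × ℂ // ‖u.1‖ ^ 2 + ‖u.2‖ ^ 2 = 1}

instance : TopologicalSpace ThreeSphere :=
  inferInstanceAs (TopologicalSpace {u : ℂ × ℂ // ‖u.1‖ ^ 2 + ‖u.2‖ ^ 2 = 1})

/-- The point `e^{2πi t/p}` of the unit circle. -/
def unitRot (p : ℕ) (t : ℝ) : ℂ := Complex.exp ((2 * π * t / p : ℝ) * Complex.I)

theorem norm_unitRot (p : ℕ) (t : ℝ) : ‖unitRot p t‖ = 1 :=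
  Complex.norm_exp_ofReal_mul_I _

theorem unitRot_add (p : ℕ) (s t : ℝ) : unitRot p (s + t) = unitRot p s * unitRot p t := by
  rw [unitRot, unitRot, unitRot, ← Complex.exp_add]
  congr 1
  push_cast
  ring

theorem unitRot_zero (p : ℕ) : unitRot p 0 = 1 := by simp [unitRot]

/-- The deck transformation `(u₁, u₂) ↦ (ω^k u₁, ω^{qk} u₂)` of `S³`, where `ω = e^{2πi/p}`. -/
def deck (p : ℕ) (q k : ℤ) (u : ThreeSphere) : ThreeSphere :=
  ⟨(unitRot p k * u.1.1, unitRot p (q * k) * u.1.2), by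
    simpa [norm_unitRot] using u.2⟩

theorem deck_zero (p : ℕ) (q : ℤ) (u : ThreeSphere) : deck p q 0 u = u := by
  apply Subtype.ext
  simp [deck, unitRot_zero]

theorem deck_add (p : ℕ) (q k l : ℤ) (u : ThreeSphere) :
    deck p q (k + l) u = deck p q k (deck p q l u) := by
  apply Subtype.ext
  simp only [deck, Int.cast_add, mul_add, unitRot_add, mul_assoc]

/-- The orbit relation of the cyclic group generated by `(u₁, u₂) ↦ (ω u₁, ω^q u₂)`. -/
def lensSetoid (p : ℕ) (q : ℤ) : Setoid ThreeSphere where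
  r u v := ∃ k : ℤ, v = deck p q k u
  iseqv :=
    { refl := fun u => ⟨0, (deck_zero p q u).symm⟩
      symm := by
        rintro u v ⟨k, rfl⟩
        exact ⟨-k, by rw [← deck_add, neg_add_cancel, deck_zero]⟩
      trans := by
        rintro u v w ⟨k, rfl⟩ ⟨l, rfl⟩
        exact ⟨l + k, by rw [deck_add]⟩ }

/-- The lens space `L(p,q)`, the quotient of `S³` by `(u₁, u₂) ∼ (ω u₁, ω^q u₂)`. -/
def LensSpace (p : ℕ) (q : ℤ) : Type := Quotient (lensSetoid p q)

instance (p : ℕ) (q : ℤ) : TopologicalSpace (LensSpace p q) :=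
  inferInstanceAs (TopologicalSpace (Quotient (lensSetoid p q)))

/-- The covering projection `S³ → L(p,q)`. -/
def lensProj (p : ℕ) (q : ℤ) (u : ThreeSphere) : LensSpace p q :=
  Quotient.mk (lensSetoid p q) u

/-- The loop `K` in `L(p,q)` represents `i` times the generator `γ` of `H₁(L(p,q)) ≅ ℤ/p`. Since
`S³ → L(p,q)` is the universal covering and its group of deck transformations `ℤ/p` is abelian,
`H₁(L(p,q))` is that group, and the class of `K` is the deck transformation that takes the initial
point of a lift of `K` to its end point. The generator `γ` is the class of the core `u₂ = 0` of the
solid torus `|u₂| ≤ 1/√2`, for which a lift runs from `(1, 0)` to `(ω, 0)`. -/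
def HasHomologyClass (p : ℕ) (q : ℤ) (K : UnitAddCircle → LensSpace p q) (i : ZMod p) : Prop :=
  ∃ z : C(unitInterval, ThreeSphere), ∃ k : ℤ,
    (∀ t : unitInterval, lensProj p q (z t) = K ((t : ℝ) : UnitAddCircle)) ∧
      z 1 = deck p q k (z 0) ∧ (k : ZMod p) = i

/-! ### Oriented links up to ambient isotopy -/

/-- Ambient isotopy of oriented links. An oriented link in `M` with components indexed by `ι` is
given by an injective parametrization `L : ι × ℝ/ℤ → M` by oriented circles. Two links are
isotopic if some isotopy `H` of `M`, starting at the identity, ends at a homeomorphism that carries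
the components of the first to the components of the second, preserving their orientations. -/
def AmbientIsotopic {M ι ι' : Type*} [TopologicalSpace M]
    (L : ι × UnitAddCircle → M) (L' : ι' × UnitAddCircle → M) : Prop :=
  ∃ H : unitInterval → M ≃ₜ M,
    Continuous (fun x : unitInterval × M => H x.1 x.2) ∧
    H 0 = Homeomorph.refl M ∧
    ∃ (e : ι ≃ ι') (f : ι → CircleDeg1Lift), ∀ i,
      Continuous (f i) ∧ StrictMono (f i) ∧
        ∀ t : ℝ, H 1 (L (i, (t : UnitAddCircle))) = L' (e i, ((f i t : ℝ) : UnitAddCircle))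

/-! ### Toroidal grid diagrams -/

/-- A toroidal grid diagram with `n` rows and `n` columns in `L(p,q)`, recorded by the fundamental
parallelograms of its markings. In straightened coordinates `(θ₁, θ₂)` the torus is
`ℝ²` modulo `(θ₁, θ₂) ∼ (θ₁ + p, θ₂) ∼ (θ₁ + q, θ₂ + 1)`, the `r`-th row is
`r/n < θ₂ < (r+1)/n` (modulo `1`), and the `c`-th column is `c/n < θ₁ < (c+1)/n` (modulo `1`). The
row `r` and the column `c` meet in `p` parallelograms, one for each cell `a ∈ ℤ/p`, in which
`a + c/n < θ₁ < a + (c+1)/n` and `r/n < θ₂ < (r+1)/n`. -/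
structure GridDiagram (p : ℕ) where
  /-- the grid number -/
  n : ℕ
  /-- the row of the `O` in each column -/
  oRow : Equiv.Perm (Fin n)
  /-- the cell of the `O` in each column -/
  oCell : Fin n → ZMod p
  /-- the row of the `X` in each column -/
  xRow : Equiv.Perm (Fin n)
  /-- the cell of the `X` in each column -/
  xCell : Fin n → ZMod p

namespace GridDiagram

variable {p : ℕ}

/-- From a column follow the vertical arc to its `X`, then the horizontal arc to the `O` in the row
of this `X`; the result is the column of this `O`. -/
def next (D : GridDiagram p) : Equiv.Perm (Fin D.n) := D.xRow.trans D.oRow.symm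

/-- The components of the diagram; each is given by its set of columns. -/
def Component (D : GridDiagram p) : Type := Quotient (Equiv.Perm.SameCycle.setoid D.next)

/-- The grid number (number of columns) of a component. -/
def componentGridNumber (D : GridDiagram p) (C : D.Component) : ℕ :=
  Nat.card {c : Fin D.n // Quotient.mk (Equiv.Perm.SameCycle.setoid D.next) c = C}

/-! The markings in coordinates `(θ₁, θ₂)`. An `O` sits at one third and an `X` at two thirds of the
width and of the height of its parallelogram, so that they are distinct even in one parallelogram. -/

def oX (D : GridDiagram p) (c : Fin D.n) : ℝ := (D.oCell c).val + ((c : ℕ) + 1 / 3) / D.n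

def oY (D : GridDiagram p) (c : Fin D.n) : ℝ := ((D.oRow c : ℕ) + 1 / 3) / D.n

def xX (D : GridDiagram p) (c : Fin D.n) : ℝ := (D.xCell c).val + ((c : ℕ) + 2 / 3) / D.n

def xY (D : GridDiagram p) (c : Fin D.n) : ℝ := ((D.xRow c : ℕ) + 2 / 3) / D.n

/-- The number of times (in `ℤ/p`) that an upward vertical arc from the `O` to the `X` of the
column `c` crosses the horizontal circle `θ₂ = 0`: one crossing lowers the cell by `q`. -/
def crossings (q : ℤ) (D : GridDiagram p) (c : Fin D.n) : ZMod p :=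
  (D.oCell c - D.xCell c) * (q : ZMod p)⁻¹

end GridDiagram

/-! ### The link associated to a grid diagram

The point `(θ₁, θ₂)` of the torus is the image of
`(e^{2πi θ₂/p}, e^{2πi θ₁/p}) / √2 ∈ S³`; the horizontal circles bound meridian discs of
`V^α = {|u₂| ≤ 1/√2}`, and the curves that run in the direction of `θ₂` bound meridian discs of
`V^β = {|u₁| ≤ 1/√2}`. -/

/-- The identification of (unit disc) × (circle) with the preimage of `V^α` in `S³`:
`w` is the disc coordinate, `y` the height `θ₂`. -/
def alphaPoint (p : ℕ) (y : ℝ) (w : ℂ) : ThreeSphere :=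
  ⟨(unitRot p y / (√(1 + ‖w‖ ^ 2) : ℝ), w / (√(1 + ‖w‖ ^ 2) : ℝ)), by
    have h : (0 : ℝ) < 1 + ‖w‖ ^ 2 := by positivity
    simp only [norm_div, norm_unitRot, Complex.norm_real, Real.norm_eq_abs, div_pow, sq_abs,
      Real.sq_sqrt h.le]
    field_simp⟩

/-- The identification of (circle) × (unit disc) with the preimage of `V^β` in `S³`:
`w` is the disc coordinate, `x` the coordinate `θ₁`. -/
def betaPoint (p : ℕ) (x : ℝ) (w : ℂ) : ThreeSphere :=
  ⟨(w / (√(1 + ‖w‖ ^ 2) : ℝ), unitRot p x / (√(1 + ‖w‖ ^ 2) : ℝ)), by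
    have h : (0 : ℝ) < 1 + ‖w‖ ^ 2 := by positivity
    simp only [norm_div, norm_unitRot, Complex.norm_real, Real.norm_eq_abs, div_pow, sq_abs,
      Real.sq_sqrt h.le]
    field_simp
    ring⟩

namespace GridDiagram

variable {p : ℕ}

/-- The vertical arc, `0 ≤ s ≤ 1`, from the `O` to the `X` of the column `c`, pushed into `V^β`:
a chord in (column) × (disc). In `S³` it ends at the lift of the `X` that lies in the same lift of
the column, at height `θ₂ + crossings`. -/
def verticalArc (q : ℤ) (D : GridDiagram p) (c : Fin D.n) (s : ℝ) : ThreeSphere :=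
  betaPoint p (D.oX c + s * (1 / 3 / D.n))
    ((1 - s) * unitRot p (D.oY c) + s * unitRot p (D.xY c + (D.crossings q c).val))

/-- The horizontal arc, `0 ≤ s ≤ 1`, from the `X` of the column `c` to the `O` in the same row,
pushed into `V^α`: a chord in (row) × (disc). -/
def horizontalArc (D : GridDiagram p) (c : Fin D.n) (s : ℝ) : ThreeSphere :=
  alphaPoint p ((1 - s) * D.xY c + s * D.oY (D.next c))
    ((1 - s) * unitRot p (D.xX c) + s * unitRot p (D.oX (D.next c)))

/-- The vertical arc of the column `c` followed by the horizontal arc at its end, `0 ≤ s ≤ 1`. -/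
def doubleArc (q : ℤ) (D : GridDiagram p) (c : Fin D.n) (s : ℝ) : LensSpace p q :=
  if s ≤ 1 / 2 then lensProj p q (D.verticalArc q c (2 * s))
  else lensProj p q (D.horizontalArc c (2 * s - 1))

/-- The oriented link in `L(p,q)` associated to a grid diagram: a component with `m` columns, one
of which is `c`, is the concatenation of the `m` arcs
`doubleArc c, doubleArc (next c), …, doubleArc (next^{m-1} c)`. -/
def link (q : ℤ) (D : GridDiagram p) : D.Component × UnitAddCircle → LensSpace p q := fun x =>
  let c : Fin D.n := Quotient.out x.1
  let s : ℝ := D.componentGridNumber x.1 * (AddCircle.equivIco (1 : ℝ) 0 x.2 : ℝ)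
  D.doubleArc q ((D.next ^ ⌊s⌋₊) c) (s - ⌊s⌋₊)

/-! ### The lift to `S³` and the function `scr` -/

theorem coe_mul_inv_of_isCoprime {q : ℤ} (hq : IsCoprime (p : ℤ) q) :
    (q : ZMod p) * (q : ZMod p)⁻¹ = 1 := by
  apply ZMod.mul_inv_of_unit
  obtain ⟨a, b, h⟩ := hq
  have h' : (b : ZMod p) * (q : ZMod p) = 1 := by
    have := congrArg (Int.cast : ℤ → ZMod p) h
    simpa using this
  exact IsUnit.of_mul_eq_one_right _ h'

/-- Given the rows and cells of the markings of one kind, the row of the marking of this kind in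
each column of the lift. The lifted torus is `ℝ²/pℤ²`, with columns `(j, c)` given by
`j + c/n < θ₁ < j + (c+1)/n` and rows `(k, r)` given by `k + r/n < θ₂ < k + (r+1)/n`. The lift at
level `k` of a point of cell `a` has cell `a + k q`, so the lift in column `(j, c)` has level `k`
with `a + k q = j`. -/
def liftRows [NeZero p] {q : ℤ} (hq : IsCoprime (p : ℤ) q) {n : ℕ}
    (row : Equiv.Perm (Fin n)) (cell : Fin n → ZMod p) :
    ZMod p × Fin n ≃ ZMod p × Fin n where
  toFun x := ((x.1 - cell x.2) * (q : ZMod p)⁻¹, row x.2)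
  invFun y := (cell (row.symm y.2) + y.1 * q, row.symm y.2)
  left_inv x := by
    have h := coe_mul_inv_of_isCoprime hq
    ext1
    · simp only [Equiv.symm_apply_apply]
      rw [mul_assoc, mul_comm _ (q : ZMod p), h]
      ring
    · simp
  right_inv y := by
    have h := coe_mul_inv_of_isCoprime hq
    ext1
    · simp only [add_sub_cancel_left]
      rw [mul_assoc, h, mul_one]
    · simp

/-- Number the pairs `(j, c)`, `0 ≤ j < p`, `0 ≤ c < n`, as `j n + c`. -/
def liftIndex (p n : ℕ) [NeZero p] : ZMod p × Fin n ≃ Fin (p * n) :=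
  ((ZMod.finEquiv p).symm.toEquiv.prodCongr (Equiv.refl (Fin n))).trans finProdFinEquiv

/-- The lift of a grid diagram to `S³ = L(1,0)`, a grid diagram with grid number `p n`. -/
def lift [NeZero p] {q : ℤ} (hq : IsCoprime (p : ℤ) q) (D : GridDiagram p) : GridDiagram 1 where
  n := p * D.n
  oRow := (liftIndex p D.n).permCongr (liftRows hq D.oRow D.oCell)
  oCell := fun _ => 0
  xRow := (liftIndex p D.n).permCongr (liftRows hq D.xRow D.xCell)
  xCell := fun _ => 0

/-- Two columns of a grid diagram in `S³` are interleaving if the rows of the markings of the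
second lie in different components of the complement of the rows of the markings of the first. -/
def Interleaving (D : GridDiagram 1) (c₁ c₂ : Fin D.n) : Prop :=
  let inside : Fin D.n → Prop := fun r =>
    min (D.oRow c₁) (D.xRow c₁) < r ∧ r < max (D.oRow c₁) (D.xRow c₁)
  let outside : Fin D.n → Prop := fun r =>
    r < min (D.oRow c₁) (D.xRow c₁) ∨ max (D.oRow c₁) (D.xRow c₁) < r
  (inside (D.oRow c₂) ∧ outside (D.xRow c₂)) ∨ (outside (D.oRow c₂) ∧ inside (D.xRow c₂))

/-- `scr D` is the number of (unordered) interleaving pairs of columns of the lift of `D`. -/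
def scr [NeZero p] {q : ℤ} (hq : IsCoprime (p : ℤ) q) (D : GridDiagram p) : ℕ :=
  Nat.card {x : Fin (D.lift hq).n × Fin (D.lift hq).n //
    x.1 < x.2 ∧ (D.lift hq).Interleaving x.1 x.2}

/-! ### Trivial links -/

/-- The set of all grid diagrams all of whose components have grid number one, with exactly `I i`
components of homology class `i` for each `i ∈ ℤ/p`. -/
def diagramsOfType (q : ℤ) (I : ZMod p → ℕ) : Set (GridDiagram p) :=
  {D | (∀ C : D.Component, D.componentGridNumber C = 1) ∧
    ∀ i : ZMod p, Nat.card
      {C : D.Component // HasHomologyClass p q (fun t => D.link q (C, t)) i} = I i}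

/-- The bijection `σ` with `σ(l) q ≡ l` modulo `p`. -/
def sigma (p : ℕ) (q : ℤ) (l : ℕ) : ZMod p := (l : ZMod p) * (q : ZMod p)⁻¹

/-- The block of column `c` (counted from `0`): the `l` with
`∑_{k < l} I(σ k) ≤ c < ∑_{k ≤ l} I(σ k)`. -/
def block (q : ℤ) (I : ZMod p → ℕ) (c : ℕ) : ℕ :=
  sInf {l : ℕ | c < ∑ k ∈ Finset.range (l + 1), I (sigma p q k)}

/-- The trivial link diagram `D(I)`, with grid number `∑ I i`: the `O`s lie in cell `0` on the
descending diagonal; the `X` of a column in block `l` is the end point in the same row of the upward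
vertical arc from the `O` that crosses the circle `θ₂ = 0` exactly `σ(l)` times. -/
def trivialDiagram [NeZero p] (q : ℤ) (I : ZMod p → ℕ) : GridDiagram p where
  n := ∑ i, I i
  oRow := Fin.revPerm
  oCell := fun _ => 0
  xRow := Fin.revPerm
  xCell := fun c => 0 - sigma p q (block q I c) * q

end GridDiagram

end

/-! `scr` is constant on the diagrams of type `I`, so every member attains the minimum; the trivial
diagram itself is the required one, with the identity as isotopy.

In a component of grid number one, `O` and `X` share a row, and the homology class is the number of
crossings of the vertical arc with `θ₂ = 0`. This is read off a lift of the loop to `S³`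
(`hasHomologyClass_link_iff`), since the class does not depend on the lift. Membership in the type
thereby becomes a condition on the crossing numbers alone (`mem_diagramsOfType_iff`).

Index the columns of the lift by the level `k` of their `O` and the column downstairs. Over a column
with row `r` and class `s`, the marking rows are `(k, r)` and `(k + s, r)`, with `k` running through
`ℤ/p`. Hence `2 * scr` is a sum over ordered pairs of columns of counts `chordPairs r r' s s'`
(`two_mul_scr`). Such a count depends on the rows only through whether `r = r'`: if the order of two
rows is exchanged, the reversal `k ↦ -1 - s - k` of the levels restores it (`chordPairs_congr`). A
bijection of columns preserving the classes therefore matches the sums for any two diagrams of the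
same type. -/

/-- The identity isotopy. -/
theorem AmbientIsotopic.refl {M ι : Type*} [TopologicalSpace M] (L : ι × UnitAddCircle → M) :
    AmbientIsotopic L L :=
  ⟨fun _ => Homeomorph.refl M, continuous_snd, rfl, Equiv.refl ι, fun _ => 1, fun _ =>
    ⟨by simpa using continuous_id, fun x y h => by simpa using h, fun t => by simp⟩⟩

/-! ### Lifts of loops to the three-sphere -/

theorem unitRot_eq_one_iff (p : ℕ) [NeZero p] (k : ℤ) : unitRot p k = 1 ↔ (k : ZMod p) = 0 := by
  have hp : (p : ℂ) ≠ 0 := Nat.cast_ne_zero.2 (NeZero.ne p)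
  rw [unitRot, Complex.exp_eq_one_iff, ZMod.intCast_zmod_eq_zero_iff_dvd]
  have hpi : (2 * (π : ℂ) * Complex.I) ≠ 0 := Complex.two_pi_I_ne_zero
  constructor
  · rintro ⟨m, hm⟩
    refine ⟨m, ?_⟩
    push_cast at hm
    have h : (k : ℂ) * (2 * π * Complex.I) = (p * m : ℂ) * (2 * π * Complex.I) := by
      field_simp at hm
      linear_combination (2 * π * Complex.I) * hm
    exact_mod_cast mul_right_cancel₀ hpi h
  · rintro ⟨m, rfl⟩
    refine ⟨m, ?_⟩
    push_cast
    field_simp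

theorem unitRot_add_intCast_eq_of_zmod_eq (p : ℕ) [NeZero p] (x : ℝ) {k l : ℤ}
    (h : (k : ZMod p) = l) : unitRot p (x + k) = unitRot p (x + l) := by
  have h1 : unitRot p ((k - l : ℤ) : ℝ) = 1 := (unitRot_eq_one_iff p _).2 (by simp [h])
  have h2 : x + (k : ℝ) = (x + l) + ((k - l : ℤ) : ℝ) := by push_cast; ring
  rw [h2, unitRot_add, h1, mul_one]

theorem deck_congr (p : ℕ) [NeZero p] (q : ℤ) {k l : ℤ} (h : (k : ZMod p) = l) (u : ThreeSphere) :
    deck p q k u = deck p q l u := by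
  have h1 := unitRot_add_intCast_eq_of_zmod_eq p 0 h
  have h2 := unitRot_add_intCast_eq_of_zmod_eq p 0 (k := q * k) (l := q * l) (by simp [h])
  apply Subtype.ext
  simp only [zero_add, Int.cast_mul] at h1 h2
  simp only [deck, h1, h2]

/-- The action of `ℤ/p` is free: a nonzero first coordinate detects the rotation by `k - l`. On the
circle `u₁ = 0` only the rotation by `q (k - l)` is visible, and there `q` has to be invertible
modulo `p`. -/
theorem deck_injective_index (p : ℕ) [NeZero p] {q : ℤ} (hq : IsCoprime (p : ℤ) q) {k l : ℤ}
    {u : ThreeSphere} (h : deck p q k u = deck p q l u) : (k : ZMod p) = l := by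
  have h0 : deck p q (k - l) u = u := by
    have := congrArg (deck p q (-l)) h
    rwa [← deck_add, ← deck_add, neg_add_cancel, deck_zero, neg_add_eq_sub] at this
  have h1 : unitRot p ((k - l : ℤ) : ℝ) * u.1.1 = u.1.1 := congrArg (fun v => v.1.1) h0
  have h2 : unitRot p ((q * (k - l) : ℤ) : ℝ) * u.1.2 = u.1.2 := by
    have := congrArg (fun v => v.1.2) h0
    simpa [deck] using this
  rw [← sub_eq_zero, ← Int.cast_sub]
  by_cases hu : u.1.1 = 0
  · have hv : u.1.2 ≠ 0 := by
      intro hv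
      have := u.2
      simp [hu, hv] at this
    have h3 := (unitRot_eq_one_iff p _).1 ((mul_eq_right₀ hv).1 h2)
    rw [Int.cast_mul] at h3
    have hqq := GridDiagram.coe_mul_inv_of_isCoprime hq
    calc ((k - l : ℤ) : ZMod p) = ((q : ZMod p) * (q : ZMod p)⁻¹) * ((k - l : ℤ) : ZMod p) := by
          rw [hqq, one_mul]
      _ = (q : ZMod p)⁻¹ * (q * ((k - l : ℤ) : ZMod p)) := by ring
      _ = 0 := by rw [h3, mul_zero]
  · exact (unitRot_eq_one_iff p _).1 ((mul_eq_right₀ hu).1 h1)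

theorem ThreeSphere.continuous_mk {X : Type*} [TopologicalSpace X] {f : X → ThreeSphere}
    (h₁ : Continuous fun x => (f x).1.1) (h₂ : Continuous fun x => (f x).1.2) : Continuous f :=
  Continuous.subtype_mk (f := fun x => (f x).1) (h₁.prodMk h₂) fun x => (f x).2

theorem ThreeSphere.continuous_val : Continuous (Subtype.val : ThreeSphere → ℂ × ℂ) :=
  continuous_subtype_val

instance : T2Space ThreeSphere :=
  inferInstanceAs (T2Space {u : ℂ × ℂ // ‖u.1‖ ^ 2 + ‖u.2‖ ^ 2 = 1})

theorem continuous_unitRot (p : ℕ) : Continuous (unitRot p) := by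
  unfold unitRot
  fun_prop

theorem continuous_deck (p : ℕ) (q k : ℤ) : Continuous (deck p q k) :=
  ThreeSphere.continuous_mk
    (continuous_const.mul (continuous_fst.comp ThreeSphere.continuous_val))
    (continuous_const.mul (continuous_snd.comp ThreeSphere.continuous_val))

theorem lensProj_eq_iff (p : ℕ) (q : ℤ) (u v : ThreeSphere) :
    lensProj p q u = lensProj p q v ↔ ∃ k : ℤ, v = deck p q k u :=
  Quotient.eq (r := lensSetoid p q)

theorem lensProj_deck (p : ℕ) (q k : ℤ) (u : ThreeSphere) :
    lensProj p q (deck p q k u) = lensProj p q u :=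
  ((lensProj_eq_iff p q _ _).2 ⟨k, rfl⟩).symm

/-- Two lifts of the same path differ by a deck transformation. -/
theorem exists_eq_deck_of_lifts (p : ℕ) [NeZero p] {q : ℤ} (hq : IsCoprime (p : ℤ) q)
    (z w : C(unitInterval, ThreeSphere)) (h : ∀ t, lensProj p q (z t) = lensProj p q (w t)) :
    ∃ k : ℤ, ∀ t, w t = deck p q k (z t) := by
  have hk : ∀ t, ∃ k : ℤ, w t = deck p q k (z t) := fun t => (lensProj_eq_iff p q _ _).1 (h t)
  choose k hk using hk
  -- By freeness the level sets of the index are coincidence sets of continuous maps, hence closed.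
  -- There are finitely many of them, so they are also open, and the index is constant on the
  -- interval.
  have hloc : IsLocallyConstant fun t => (k t : ZMod p) := by
    have hset : ∀ a : ZMod p,
        {t | (k t : ZMod p) = a} = {t | w t = deck p q (a.val : ℤ) (z t)} := fun a => by
      ext t
      simp only [Set.mem_ofPred_eq]
      have ha : (((a.val : ℕ) : ℤ) : ZMod p) = a := by simp
      refine ⟨fun h => (hk t).trans (deck_congr p q (h.trans ha.symm) _), fun h => ?_⟩
      exact (deck_injective_index p hq ((hk t).symm.trans h)).trans ha
    have hclosed : ∀ a : ZMod p, IsClosed {t | (k t : ZMod p) = a} := fun a => by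
      rw [hset]
      exact isClosed_eq w.continuous ((continuous_deck p q _).comp z.continuous)
    intro s
    rw [← isClosed_compl_iff, ← Set.preimage_compl, ← Set.biUnion_preimage_singleton]
    exact (Set.toFinite sᶜ).isClosed_biUnion fun a _ => hclosed a
  refine ⟨k 0, fun t => ?_⟩
  rw [hk t]
  exact deck_congr p q (hloc.apply_eq_of_preconnectedSpace t 0) _

/-- The homology class of a loop is determined by any one of its lifts. -/
theorem hasHomologyClass_iff_of_lift (p : ℕ) [NeZero p] {q : ℤ} (hq : IsCoprime (p : ℤ) q)
    {K : UnitAddCircle → LensSpace p q} (z : C(unitInterval, ThreeSphere)) (k : ℤ)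
    (hz : ∀ t : unitInterval, lensProj p q (z t) = K ((t : ℝ) : UnitAddCircle))
    (hk : z 1 = deck p q k (z 0)) (i : ZMod p) :
    HasHomologyClass p q K i ↔ (k : ZMod p) = i := by
  refine ⟨?_, fun h => ⟨z, k, hz, hk, h⟩⟩
  rintro ⟨w, l, hw, hl, rfl⟩
  obtain ⟨m, hm⟩ := exists_eq_deck_of_lifts p hq z w fun t => (hz t).trans (hw t).symm
  -- Deck transformations commute, so the shift `m` between the two lifts cancels from the end point
  -- condition.
  rw [hm, hm, hk, ← deck_add, ← deck_add, add_comm l] at hl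
  have := deck_injective_index p hq hl
  push_cast at this
  exact add_left_cancel this

/-! ### Coordinates of the two solid tori -/

theorem continuous_alphaPoint (p : ℕ) : Continuous fun x : ℝ × ℂ => alphaPoint p x.1 x.2 := by
  have h : Continuous fun x : ℝ × ℂ => ((√(1 + ‖x.2‖ ^ 2) : ℝ) : ℂ) := by fun_prop
  have h0 : ∀ x : ℝ × ℂ, ((√(1 + ‖x.2‖ ^ 2) : ℝ) : ℂ) ≠ 0 := fun x =>
    Complex.ofReal_ne_zero.2 (by positivity)
  exact ThreeSphere.continuous_mk (((continuous_unitRot p).comp continuous_fst).div h h0)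
    (continuous_snd.div h h0)

theorem continuous_betaPoint (p : ℕ) : Continuous fun x : ℝ × ℂ => betaPoint p x.1 x.2 := by
  have h : Continuous fun x : ℝ × ℂ => ((√(1 + ‖x.2‖ ^ 2) : ℝ) : ℂ) := by fun_prop
  have h0 : ∀ x : ℝ × ℂ, ((√(1 + ‖x.2‖ ^ 2) : ℝ) : ℂ) ≠ 0 := fun x =>
    Complex.ofReal_ne_zero.2 (by positivity)
  exact ThreeSphere.continuous_mk (continuous_snd.div h h0)
    (((continuous_unitRot p).comp continuous_fst).div h h0)

/-- On the Heegaard torus the coordinates of the two solid tori agree. -/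
theorem betaPoint_unitRot (p : ℕ) (x y : ℝ) :
    betaPoint p x (unitRot p y) = alphaPoint p y (unitRot p x) := by
  apply Subtype.ext
  simp [betaPoint, alphaPoint, norm_unitRot]

theorem deck_alphaPoint_unitRot (p : ℕ) (q k : ℤ) (x y : ℝ) :
    deck p q k (alphaPoint p y (unitRot p x)) = alphaPoint p (y + k) (unitRot p (x + q * k)) := by
  apply Subtype.ext
  simp only [deck, alphaPoint, unitRot_add, norm_mul, norm_unitRot]
  ext1 <;> simp only [mul_one] <;> ring

namespace GridDiagram

variable {p : ℕ}

/-! ### Components of grid number one -/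

theorem _root_.Equiv.Perm.SameCycle.eq_of_eq_one {α : Type*} {f : Equiv.Perm α} {a b : α}
    (h : f.SameCycle a b) (hf : f = 1) : a = b := by
  subst hf
  exact Equiv.Perm.sameCycle_one.1 h

/-- A column and its image under `next` always lie in one component, so size one forces them to be
equal. -/
theorem card_component_eq_one_iff (D : GridDiagram p) :
    (∀ C : D.Component, D.componentGridNumber C = 1) ↔ D.next = 1 := by
  constructor
  · intro h
    ext1 c
    have h1 := h (Quotient.mk (Equiv.Perm.SameCycle.setoid D.next) c)
    unfold componentGridNumber at h1
    rw [Nat.card_eq_one_iff_unique] at h1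
    have h2 := h1.1.elim ⟨D.next c, Quotient.sound (s := Equiv.Perm.SameCycle.setoid D.next)
      (Equiv.Perm.SameCycle.refl D.next c).apply_left⟩ ⟨c, rfl⟩
    exact congrArg Subtype.val h2
  · intro h C
    induction C using Quotient.inductionOn with
    | _ c =>
      unfold componentGridNumber
      rw [Nat.card_eq_one_iff_unique]
      refine ⟨⟨fun a b => Subtype.ext ?_⟩, ⟨⟨c, rfl⟩⟩⟩
      have hab := Quotient.exact (s := Equiv.Perm.SameCycle.setoid D.next) (a.2.trans b.2.symm)
      exact Equiv.Perm.SameCycle.eq_of_eq_one hab h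

/-- If `next` is the identity then components are columns. -/
noncomputable def columnEquivComponent (D : GridDiagram p) (h : D.next = 1) : Fin D.n ≃ D.Component where
  toFun c := Quotient.mk (Equiv.Perm.SameCycle.setoid D.next) c
  invFun C := Quotient.out C
  left_inv c := by
    have hc := Quotient.mk_out (s := Equiv.Perm.SameCycle.setoid D.next) c
    exact Equiv.Perm.SameCycle.eq_of_eq_one hc h
  right_inv C := Quotient.out_eq C

theorem link_apply_of_next_eq_one (q : ℤ) (D : GridDiagram p) (h : D.next = 1) (c : Fin D.n)
    {t : ℝ} (ht : t ∈ Set.Ico (0 : ℝ) 1) :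
    D.link q (D.columnEquivComponent h c, (t : UnitAddCircle)) = D.doubleArc q c t := by
  have h1 : D.componentGridNumber (D.columnEquivComponent h c) = 1 :=
    (card_component_eq_one_iff D).2 h _
  have h2 : (AddCircle.equivIco (1 : ℝ) 0 (t : UnitAddCircle) : ℝ) = t := by
    rw [AddCircle.coe_equivIco_mk_apply]
    simpa using Int.fract_eq_self.2 ht
  have h3 : Quotient.out (D.columnEquivComponent h c) = c :=
    (D.columnEquivComponent h).symm_apply_apply c
  have h4 : ⌊t⌋₊ = 0 := Nat.floor_eq_zero.2 ht.2
  simp only [link, h1, h2, h3, Nat.cast_one, one_mul, h4, pow_zero, Equiv.Perm.one_apply,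
    Nat.cast_zero, sub_zero]

theorem continuous_verticalArc (q : ℤ) (D : GridDiagram p) (c : Fin D.n) :
    Continuous (D.verticalArc q c) :=
  (continuous_betaPoint p).comp (g := fun x : ℝ × ℂ => betaPoint p x.1 x.2)
    (f := fun s : ℝ => (D.oX c + s * (1 / 3 / D.n),
      (1 - s) * unitRot p (D.oY c) + s * unitRot p (D.xY c + (D.crossings q c).val)))
    (by fun_prop)

theorem continuous_horizontalArc (D : GridDiagram p) (c : Fin D.n) :
    Continuous (D.horizontalArc c) :=
  (continuous_alphaPoint p).comp (g := fun x : ℝ × ℂ => alphaPoint p x.1 x.2)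
    (f := fun s : ℝ => ((1 - s) * D.xY c + s * D.oY (D.next c),
      (1 - s) * unitRot p (D.xX c) + s * unitRot p (D.oX (D.next c))))
    (by fun_prop)

theorem verticalArc_zero (q : ℤ) (D : GridDiagram p) (c : Fin D.n) :
    D.verticalArc q c 0 = alphaPoint p (D.oY c) (unitRot p (D.oX c)) := by
  simp [verticalArc, betaPoint_unitRot]

theorem horizontalArc_one (D : GridDiagram p) (c : Fin D.n) :
    D.horizontalArc c 1 = alphaPoint p (D.oY (D.next c)) (unitRot p (D.oX (D.next c))) := by
  simp [horizontalArc]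

/-- The vertical arc ends at the lift of the initial point of the horizontal arc. -/
theorem verticalArc_one [NeZero p] {q : ℤ} (hq : IsCoprime (p : ℤ) q) (D : GridDiagram p)
    (c : Fin D.n) :
    D.verticalArc q c 1 = deck p q (D.crossings q c).val (D.horizontalArc c 0) := by
  -- The added third of a column width takes the offset of `O` to that of `X`. The cells then agree
  -- modulo `p`, because `q` times the crossing number is `oCell - xCell`.
  have hX : unitRot p (D.oX c + 1 / 3 / D.n) =
      unitRot p (D.xX c + q * ((D.crossings q c).val : ℤ)) := by
    have h := unitRot_add_intCast_eq_of_zmod_eq p ((((c : ℕ) : ℝ) + 2 / 3) / D.n)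
      (k := (D.oCell c).val) (l := (D.xCell c).val + q * (D.crossings q c).val) (by
        have hqq := coe_mul_inv_of_isCoprime hq
        push_cast
        simp only [ZMod.natCast_val, ZMod.cast_id', id_eq, crossings]
        linear_combination -(D.oCell c - D.xCell c) * hqq)
    convert h using 2
    · simp only [oX]
      push_cast
      ring
    · simp only [xX]
      push_cast
      ring
  have h0 : D.horizontalArc c 0 = alphaPoint p (D.xY c) (unitRot p (D.xX c)) := by
    simp [horizontalArc]
  rw [h0, deck_alphaPoint_unitRot, ← hX]
  simp [verticalArc, betaPoint_unitRot]

/-- The homology class of a component of grid number one is the number of crossings of its vertical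
arc with the circle `θ₂ = 0`. -/
theorem hasHomologyClass_link_iff [NeZero p] {q : ℤ} (hq : IsCoprime (p : ℤ) q)
    (D : GridDiagram p) (h : D.next = 1) (c : Fin D.n) (i : ZMod p) :
    HasHomologyClass p q (fun t => D.link q (D.columnEquivComponent h c, t)) i ↔
      D.crossings q c = i := by
  have hc : D.next c = c := by rw [h]; rfl
  let k : ℤ := (D.crossings q c).val
  -- The lift of the component: the vertical arc, then the horizontal arc moved by the deck
  -- transformation that makes the two meet. As `next c = c`, it ends at the translate by `k` of its
  -- initial point.
  let z : C(unitInterval, ThreeSphere) :=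
    ⟨fun t => if (t : ℝ) ≤ 1 / 2 then D.verticalArc q c (2 * t)
      else deck p q k (D.horizontalArc c (2 * t - 1)), by
      refine Continuous.if_le ?_ ?_ continuous_subtype_val continuous_const ?_
      · exact (D.continuous_verticalArc q c).comp (by fun_prop)
      · exact (continuous_deck p q k).comp ((D.continuous_horizontalArc c).comp (by fun_prop))
      · intro t ht
        rw [ht]
        norm_num
        exact D.verticalArc_one hq c⟩
  have hz0 : z 0 = D.verticalArc q c 0 := by
    change (if ((0 : unitInterval) : ℝ) ≤ 1 / 2 then _ else _) = _
    norm_num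
  have hz1 : z 1 = deck p q k (D.horizontalArc c 1) := by
    change (if ((1 : unitInterval) : ℝ) ≤ 1 / 2 then _ else _) = _
    norm_num
  have hend : z 1 = deck p q k (z 0) := by
    rw [hz0, hz1, verticalArc_zero, horizontalArc_one, hc]
  have key := hasHomologyClass_iff_of_lift p hq
    (K := fun t => D.link q (D.columnEquivComponent h c, t)) z k (fun t => ?_) hend i
  · rw [key]
    simp [k]
  · have hlt : ∀ s : unitInterval, (s : ℝ) < 1 → lensProj p q (z s) =
        D.link q (D.columnEquivComponent h c, ((s : ℝ) : UnitAddCircle)) := by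
      intro s hs
      rw [link_apply_of_next_eq_one q D h c ⟨s.2.1, hs⟩, doubleArc]
      change lensProj p q (if (s : ℝ) ≤ 1 / 2 then _ else _) = _
      split_ifs
      · rfl
      · exact lensProj_deck p q k _
    rcases t.2.2.lt_or_eq with ht | ht
    · exact hlt t ht
    -- The circle is parametrized by `[0, 1)`, so the end point is compared with the initial one
    -- instead.
    · have h1 : t = 1 := Subtype.ext ht
      have h2 : (((1 : unitInterval) : ℝ) : UnitAddCircle) = (((0 : unitInterval) : ℝ) : UnitAddCircle) := by
        simp
      rw [h1, hend, lensProj_deck, hlt 0 (by norm_num), h2]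

/-- Replaces the topological conditions by combinatorial ones: components become columns, homology
classes become crossing numbers. -/
theorem mem_diagramsOfType_iff [NeZero p] {q : ℤ} (hq : IsCoprime (p : ℤ) q) (I : ZMod p → ℕ)
    (D : GridDiagram p) :
    D ∈ diagramsOfType q I ↔
      D.next = 1 ∧ ∀ i, Nat.card {c : Fin D.n // D.crossings q c = i} = I i := by
  rw [diagramsOfType, Set.mem_ofPred_eq, card_component_eq_one_iff]
  refine and_congr_right fun h => forall_congr' fun i => ?_
  rw [Nat.card_congr ((D.columnEquivComponent h).subtypeEquiv
    (q := fun C => HasHomologyClass p q (fun t => D.link q (C, t)) i) fun c => (hasHomologyClass_link_iff hq D h c i).symm)]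

/-! ### Counting interleaving columns -/

/-- The pairs `{a, b}` and `{c, d}` separate each other. -/
def Separates {α : Type*} [LinearOrder α] (a b c d : α) : Prop :=
  ((min a b < c ∧ c < max a b) ∧ (d < min a b ∨ max a b < d)) ∨
    ((c < min a b ∨ max a b < c) ∧ (min a b < d ∧ d < max a b))

/-- Without `min` and `max`, only comparisons between an end of one pair and an end of the other
remain; this is why eight equivalences suffice in the congruence lemmas. -/
theorem separates_iff {α : Type*} [LinearOrder α] (a b c d : α) :
    Separates a b c d ↔
      (((a < c ∨ b < c) ∧ (c < a ∨ c < b)) ∧ ((d < a ∧ d < b) ∨ (a < d ∧ b < d))) ∨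
        (((c < a ∧ c < b) ∨ (a < c ∧ b < c)) ∧ ((a < d ∨ b < d) ∧ (d < a ∨ d < b))) := by
  simp only [Separates, min_lt_iff, lt_max_iff, lt_min_iff, max_lt_iff]

theorem Separates.symm {n : ℕ} {a b c d : Fin n} (h : Separates a b c d) :
    Separates c d a b := by
  simp only [separates_iff, Fin.lt_def] at h ⊢
  omega

theorem not_separates_self {α : Type*} [LinearOrder α] (a b : α) : ¬ Separates a b a b := by
  rw [separates_iff]
  grind

theorem separates_congr {α β : Type*} [LinearOrder α] [LinearOrder β] {a b c d : α}
    {a' b' c' d' : β} (hac : a < c ↔ a' < c') (hca : c < a ↔ c' < a') (had : a < d ↔ a' < d')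
    (hda : d < a ↔ d' < a') (hbc : b < c ↔ b' < c') (hcb : c < b ↔ c' < b')
    (hbd : b < d ↔ b' < d') (hdb : d < b ↔ d' < b') :
    Separates a b c d ↔ Separates a' b' c' d' := by
  rw [separates_iff, separates_iff, hac, hca, had, hda, hbc, hcb, hbd, hdb]

/-- Separation is invariant under reversing the order and exchanging the ends of each pair. -/
theorem separates_congr_reverse {α β : Type*} [LinearOrder α] [LinearOrder β] {a b c d : α}
    {a' b' c' d' : β} (hac : a < c ↔ d' < b') (hca : c < a ↔ b' < d') (had : a < d ↔ c' < b')
    (hda : d < a ↔ b' < c') (hbc : b < c ↔ d' < a') (hcb : c < b ↔ a' < d')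
    (hbd : b < d ↔ c' < a') (hdb : d < b ↔ a' < c') :
    Separates a b c d ↔ Separates a' b' c' d' := by
  rw [separates_iff, separates_iff, hac, hca, had, hda, hbc, hcb, hbd, hdb]
  simp only [and_comm, or_comm]

/-! ### Order of the lifted rows and counts of separating chords -/

theorem liftIndex_lt_iff {n : ℕ} [NeZero p] (x y : ZMod p × Fin n) :
    liftIndex p n x < liftIndex p n y ↔
      x.1.val < y.1.val ∨ (x.1.val = y.1.val ∧ x.2 < y.2) := by
  have hval : ∀ x : ZMod p × Fin n, (liftIndex p n x : ℕ) = x.2 + n * x.1.val := by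
    intro x
    obtain ⟨m, rfl⟩ := Nat.exists_eq_succ_of_ne_zero (NeZero.ne p)
    rfl
  rw [Fin.lt_def, hval, hval, Fin.lt_def]
  have hx := x.2.2
  have hy := y.2.2
  generalize x.1.val = a
  generalize y.1.val = b
  rcases lt_trichotomy a b with h | rfl | h
  · have : n * (a + 1) ≤ n * b := Nat.mul_le_mul_left n h
    rw [mul_add, mul_one] at this
    simp only [h, true_or, iff_true]
    omega
  · omega
  · have : n * (b + 1) ≤ n * a := Nat.mul_le_mul_left n h
    rw [mul_add, mul_one] at this
    omega

/-- On representatives, `k ↦ -1 - k` is `v ↦ p - 1 - v`, which reverses the order of all levels; `k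
↦ -k` would fix `0`. -/
theorem val_neg_one_sub [NeZero p] (k : ZMod p) : (-1 - k).val + k.val + 1 = p := by
  have h1 := ZMod.val_lt k
  have h2 : (-1 - k : ZMod p) = ((p - 1 - k.val : ℕ) : ZMod p) := by
    rw [Nat.cast_sub (by omega), Nat.cast_sub (by omega)]
    simp
  rw [h2, ZMod.val_natCast_of_lt (by omega)]
  omega

/-- The number of separating pairs of chords, one from a rotation class of chords of length `s` in
row `r`, one from a class of chords of length `s'` in row `r'`. -/
noncomputable def chordPairs [NeZero p] {n : ℕ} (r r' : Fin n) (s s' : ZMod p) : ℕ :=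
  Nat.card {k : ZMod p × ZMod p // Separates (liftIndex p n (k.1, r)) (liftIndex p n (k.1 + s, r))
    (liftIndex p n (k.2, r')) (liftIndex p n (k.2 + s', r'))}

/-- The number of separating pairs of chords does not depend on the rows. -/
theorem chordPairs_congr [NeZero p] {n m : ℕ} {r r' : Fin n} {t t' : Fin m}
    (h : r = r' ↔ t = t') (s s' : ZMod p) : chordPairs r r' s s' = chordPairs t t' s s' := by
  have hcases : ((r < r' ↔ t < t') ∧ (r' < r ↔ t' < t)) ∨
      ((r < r' ↔ t' < t) ∧ (r' < r ↔ t < t')) := by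
    rcases lt_trichotomy r r' with h1 | h1 | h1 <;> rcases lt_trichotomy t t' with h2 | h2 | h2 <;>
      grind
  rcases hcases with ⟨h1, h2⟩ | ⟨h1, h2⟩
  · refine Nat.card_congr (Equiv.subtypeEquivRight fun k => ?_)
    apply separates_congr <;> simp only [liftIndex_lt_iff, h1, h2]
  -- The rows are in opposite order, so all levels are reversed. The chord from `k` to `k + s`
  -- becomes one from `-1 - (k + s)` to `-1 - k`: again of length `s`, with its ends exchanged.
  · refine Nat.card_congr (((Equiv.subLeft (-1 - s)).prodCongr (Equiv.subLeft (-1 - s'))).subtypeEquiv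
      fun k => ?_)
    have e : ∀ x y : ZMod p, -1 - (x + y) + y = -1 - x := fun x y => by ring
    have e' : ∀ x y : ZMod p, -1 - y - x = -1 - (x + y) := fun x y => by ring
    have hlt : ∀ x y : ZMod p, (-1 - x).val < (-1 - y).val ↔ y.val < x.val := fun x y => by
      have := val_neg_one_sub x
      have := val_neg_one_sub y
      omega
    have heq : ∀ x y : ZMod p, (-1 - x).val = (-1 - y).val ↔ y.val = x.val := fun x y => by
      have := val_neg_one_sub x
      have := val_neg_one_sub y
      omega
    apply separates_congr_reverse <;>
      simp only [liftIndex_lt_iff, Equiv.prodCongr_apply, Prod.map, Equiv.subLeft_apply, e, e',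
        hlt, heq, h1, h2]

/-! ### `scr` as a sum over pairs of columns -/

/-- The columns of the lift, recorded by the level of their `O` and the column downstairs. -/
def liftColumn [NeZero p] {q : ℤ} (hq : IsCoprime (p : ℤ) q) (D : GridDiagram p) :
    ZMod p × Fin D.n ≃ Fin (D.lift hq).n :=
  ((Equiv.prodCongr (Equiv.refl _) D.oRow).trans (liftRows hq D.oRow D.oCell).symm).trans
    (liftIndex p D.n)

theorem lift_oRow_liftColumn [NeZero p] {q : ℤ} (hq : IsCoprime (p : ℤ) q) (D : GridDiagram p)
    (x : ZMod p × Fin D.n) :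
    (D.lift hq).oRow (D.liftColumn hq x) = liftIndex p D.n (x.1, D.oRow x.2) := by
  change liftIndex p D.n (liftRows hq D.oRow D.oCell ((liftIndex p D.n).symm (liftIndex p D.n
    ((liftRows hq D.oRow D.oCell).symm (x.1, D.oRow x.2))))) = _
  rw [Equiv.symm_apply_apply, Equiv.apply_symm_apply]

/-- An `O` at level `k` lies over cell `j = oCell + k q`, and the `X` in that lifted column has
level `(j - xCell) q⁻¹ = k + (oCell - xCell) q⁻¹`. Its row downstairs is that of the `O` because
`next = 1`. -/
theorem lift_xRow_liftColumn [NeZero p] {q : ℤ} (hq : IsCoprime (p : ℤ) q) (D : GridDiagram p)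
    (h : D.next = 1) (x : ZMod p × Fin D.n) :
    (D.lift hq).xRow (D.liftColumn hq x) =
      liftIndex p D.n (x.1 + D.crossings q x.2, D.oRow x.2) := by
  have hrow : D.xRow x.2 = D.oRow x.2 := by
    have := Equiv.congr_fun h x.2
    rw [next, Equiv.trans_apply, Equiv.symm_apply_eq] at this
    exact this
  have hqq := coe_mul_inv_of_isCoprime hq
  change liftIndex p D.n (liftRows hq D.xRow D.xCell ((liftIndex p D.n).symm (liftIndex p D.n
    ((liftRows hq D.oRow D.oCell).symm (x.1, D.oRow x.2))))) = _
  rw [Equiv.symm_apply_apply]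
  refine congrArg (liftIndex p D.n) ?_
  refine Prod.ext ?_ ?_
  · simp [liftRows, crossings]
    linear_combination x.1 * hqq
  · simpa [liftRows] using hrow

theorem interleaving_iff_separates (D : GridDiagram 1) (a b : Fin D.n) :
    D.Interleaving a b ↔ Separates (D.oRow a) (D.xRow a) (D.oRow b) (D.xRow b) := Iff.rfl

/-- The number of ordered pairs related by a symmetric irreflexive relation is twice the number of
unordered ones. -/
theorem card_symmetric_relation {n : ℕ} (R : Fin n → Fin n → Prop)
    (hs : ∀ a b, R a b → R b a) (hi : ∀ a, ¬ R a a) :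
    Nat.card {x : Fin n × Fin n // R x.1 x.2} =
      2 * Nat.card {x : Fin n × Fin n // x.1 < x.2 ∧ R x.1 x.2} := by
  classical
  have hswap : Nat.card {x : Fin n × Fin n // x.1 < x.2 ∧ R x.1 x.2} =
      Nat.card {x : Fin n × Fin n // x.2 < x.1 ∧ R x.1 x.2} :=
    Nat.card_congr ((Equiv.prodComm _ _).subtypeEquiv fun x =>
      and_congr_right fun _ => ⟨hs _ _, hs _ _⟩)
  rw [two_mul]
  nth_rewrite 2 [hswap]
  simp only [Nat.card_eq_fintype_card, Fintype.card_subtype]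
  rw [← Finset.card_union_of_disjoint]
  · congr 1
    ext x
    simp only [Finset.mem_filter, Finset.mem_univ, true_and, Finset.mem_union, ← or_and_right]
    refine ⟨fun h => ⟨lt_or_gt_of_ne fun he => hi x.1 ?_, h⟩, fun h => h.2⟩
    rwa [← he] at h
  · rw [Finset.disjoint_filter]
    exact fun x _ h h' => lt_asymm h.1 h'.1

theorem two_mul_scr [NeZero p] {q : ℤ} (hq : IsCoprime (p : ℤ) q) (D : GridDiagram p)
    (h : D.next = 1) :
    2 * D.scr hq = ∑ x : Fin D.n × Fin D.n,
      chordPairs (D.oRow x.1) (D.oRow x.2) (D.crossings q x.1) (D.crossings q x.2) := by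
  classical
  rw [scr, ← card_symmetric_relation (D.lift hq).Interleaving (fun a b => Separates.symm)
    (fun a => not_separates_self _ _)]
  simp only [chordPairs]
  rw [← Nat.card_sigma]
  symm
  refine Nat.card_congr ?_
  -- A pair of columns downstairs with a pair of levels is regrouped into two (level, column) pairs,
  -- that is, two columns of the lift.
  refine (Equiv.subtypeProdEquivSigmaSubtype (α := Fin D.n × Fin D.n) (β := ZMod p × ZMod p)
    (fun x k => Separates (liftIndex p D.n (k.1, D.oRow x.1))
      (liftIndex p D.n (k.1 + D.crossings q x.1, D.oRow x.1)) (liftIndex p D.n (k.2, D.oRow x.2))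
      (liftIndex p D.n (k.2 + D.crossings q x.2, D.oRow x.2)))).symm.trans ?_
  refine (((Equiv.prodComm _ _).trans (Equiv.prodProdProdComm _ _ _ _)).trans
    ((D.liftColumn hq).prodCongr (D.liftColumn hq))).subtypeEquiv fun x => ?_
  simp only [interleaving_iff_separates, Equiv.trans_apply, Equiv.prodCongr_apply, Prod.map,
    lift_oRow_liftColumn, lift_xRow_liftColumn hq D h]
  rfl

/-- For diagrams whose components have grid number one, `scr` depends only on the homology classes
of the components. -/
theorem scr_eq_of_mem_diagramsOfType [NeZero p] {q : ℤ} (hq : IsCoprime (p : ℤ) q)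
    {I : ZMod p → ℕ} {D E : GridDiagram p} (hD : D ∈ diagramsOfType q I)
    (hE : E ∈ diagramsOfType q I) : D.scr hq = E.scr hq := by
  rw [mem_diagramsOfType_iff hq] at hD hE
  have hcard : ∀ i, Nonempty ({c : Fin D.n // D.crossings q c = i} ≃
      {c : Fin E.n // E.crossings q c = i}) := fun i =>
    ⟨(Finite.equivFinOfCardEq (hD.2 i)).trans (Finite.equivFinOfCardEq (hE.2 i)).symm⟩
  -- Columns of equal class are matched arbitrarily; their rows need not correspond, since only
  -- equality of rows matters.
  let e : Fin D.n ≃ Fin E.n := Equiv.ofFiberEquiv fun i => (hcard i).some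
  have he : ∀ c, E.crossings q (e c) = D.crossings q c := fun c =>
    Equiv.ofFiberEquiv_map _ c
  have : 2 * D.scr hq = 2 * E.scr hq := by
    rw [two_mul_scr hq D hD.1, two_mul_scr hq E hE.1]
    refine Fintype.sum_equiv (e.prodCongr e) _ _ fun x => ?_
    simp only [Equiv.prodCongr_apply, Prod.map, he]
    exact chordPairs_congr (by simp) _ _
  omega

/-! ### The trivial link diagram -/

/-- On `0 ≤ l < p` the map `σ` is a bijection onto `ℤ/p` with inverse `i ↦ (i q).val`. -/
theorem sigma_eq_iff [NeZero p] {q : ℤ} (hq : IsCoprime (p : ℤ) q) {l : ℕ} (hl : l < p)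
    (i : ZMod p) : sigma p q l = i ↔ l = (i * q).val := by
  have hqq := coe_mul_inv_of_isCoprime hq
  rw [sigma]
  constructor
  · rintro rfl
    rw [mul_assoc, mul_comm _ (q : ZMod p), hqq, mul_one, ZMod.val_natCast_of_lt hl]
  · rintro rfl
    rw [ZMod.natCast_val, ZMod.cast_id', id_eq, mul_assoc, hqq, mul_one]

theorem sum_range_sigma [NeZero p] {q : ℤ} (hq : IsCoprime (p : ℤ) q) (I : ZMod p → ℕ) :
    ∑ k ∈ Finset.range p, I (sigma p q k) = ∑ i, I i :=
  Finset.sum_bij' (fun k _ => sigma p q k) (fun i _ => (i * q).val) (fun _ _ => Finset.mem_univ _)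
    (fun _ _ => Finset.mem_range.2 (ZMod.val_lt _))
    (fun _ hk => ((sigma_eq_iff hq (Finset.mem_range.1 hk) _).1 rfl).symm)
    (fun i _ => (sigma_eq_iff hq (ZMod.val_lt _) i).2 rfl) (fun _ _ => rfl)

theorem block_eq_iff [NeZero p] {q : ℤ} (hq : IsCoprime (p : ℤ) q) (I : ZMod p → ℕ) {c : ℕ}
    (hc : c < ∑ i, I i) (l : ℕ) :
    block q I c = l ↔ ∑ k ∈ Finset.range l, I (sigma p q k) ≤ c ∧
      c < ∑ k ∈ Finset.range (l + 1), I (sigma p q k) := by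
  have hmono : Monotone fun l => ∑ k ∈ Finset.range l, I (sigma p q k) := fun a b h =>
    Finset.sum_le_sum_of_subset (Finset.range_mono h)
  -- The bound on `c` keeps the infimum in `block` from being the default value `0` of an empty set.
  have hne : {l : ℕ | c < ∑ k ∈ Finset.range (l + 1), I (sigma p q k)}.Nonempty :=
    ⟨p, (hc.trans_eq (sum_range_sigma hq I).symm).trans_le (hmono p.le_succ)⟩
  constructor
  · rintro rfl
    refine ⟨?_, Nat.sInf_mem hne⟩
    by_contra! hlt
    rcases hb : block q I c with _ | b
    · simp [hb] at hlt
    · rw [hb] at hlt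
      have : block q I c ≤ b := Nat.sInf_le hlt
      omega
  · rintro ⟨h1, h2⟩
    refine le_antisymm (Nat.sInf_le h2) (le_of_not_gt fun hlt => ?_)
    exact absurd ((Nat.sInf_mem hne).trans_le (hmono (Nat.succ_le_of_lt hlt))) (not_lt.2 h1)

/-- A block is the interval between two consecutive partial sums, whose difference is the summand `I
(σ l)`. -/
theorem card_block_eq [NeZero p] {q : ℤ} (hq : IsCoprime (p : ℤ) q) (I : ZMod p → ℕ) {l : ℕ}
    (hl : l < p) :
    Nat.card {c : Fin (∑ i, I i) // block q I c = l} = I (sigma p q l) := by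
  have hle : ∑ k ∈ Finset.range (l + 1), I (sigma p q k) ≤ ∑ i, I i := by
    rw [← sum_range_sigma hq I]
    exact Finset.sum_le_sum_of_subset (Finset.range_mono hl)
  let e : {c : Fin (∑ i, I i) // block q I c = l} ≃
      Finset.Ico (∑ k ∈ Finset.range l, I (sigma p q k))
        (∑ k ∈ Finset.range (l + 1), I (sigma p q k)) :=
    { toFun := fun c => ⟨c.1, Finset.mem_Ico.2 ((block_eq_iff hq I c.1.2 l).1 c.2)⟩
      invFun := fun c => ⟨⟨c.1, (Finset.mem_Ico.1 c.2).2.trans_le hle⟩,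
        (block_eq_iff hq I ((Finset.mem_Ico.1 c.2).2.trans_le hle) l).2 (Finset.mem_Ico.1 c.2)⟩
      left_inv := fun _ => rfl
      right_inv := fun _ => rfl }
  rw [Nat.card_congr e, Nat.card_eq_fintype_card, Fintype.card_coe, Nat.card_Ico,
    Finset.sum_range_succ, Nat.add_sub_cancel_left]

theorem trivialDiagram_mem_diagramsOfType [NeZero p] {q : ℤ} (hq : IsCoprime (p : ℤ) q)
    (I : ZMod p → ℕ) : trivialDiagram q I ∈ diagramsOfType q I := by
  have hqq := coe_mul_inv_of_isCoprime hq
  rw [mem_diagramsOfType_iff hq]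
  refine ⟨Equiv.ext fun c => Equiv.symm_apply_apply Fin.revPerm c, fun i => ?_⟩
  have hcross : ∀ c : Fin (∑ i, I i),
      (trivialDiagram q I).crossings q c = sigma p q (block q I c) := fun c => by
    simp only [crossings, trivialDiagram]
    linear_combination sigma p q (block q I c) * hqq
  -- The first `p` summands already exhaust the columns, so every block index lies in the range
  -- where `σ` is injective.
  have hblock : ∀ c : Fin (∑ i, I i), block q I c < p := fun c => by
    by_contra! h
    have h1 := ((block_eq_iff hq I c.2 _).1 rfl).1
    have h2 : ∑ k ∈ Finset.range p, I (sigma p q k) ≤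
        ∑ k ∈ Finset.range (block q I c), I (sigma p q k) :=
      Finset.sum_le_sum_of_subset (Finset.range_mono h)
    rw [sum_range_sigma hq] at h2
    have := c.2
    omega
  have hl : (i * q).val < p := ZMod.val_lt _
  rw [← (sigma_eq_iff hq hl i).2 rfl, ← card_block_eq hq I hl, (sigma_eq_iff hq hl i).2 rfl]
  refine Nat.card_congr (Equiv.subtypeEquivRight fun c : Fin (∑ i, I i) => ?_)
  exact (Eq.congr_left (hcross c)).trans (sigma_eq_iff hq (hblock c) i)

end GridDiagram

/-! ### The minimum of `scr` -/

theorem mainTheorem6 (p : ℕ) [NeZero p] (q : ℤ) (hq : IsCoprime (p : ℤ) q) (I : ZMod p → ℕ) :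
    ∃ D : GridDiagram p, D ∈ GridDiagram.diagramsOfType q I ∧
      AmbientIsotopic (D.link q) ((GridDiagram.trivialDiagram q I).link q) ∧
      IsLeast (GridDiagram.scr hq '' GridDiagram.diagramsOfType q I) (D.scr hq) := by
  have hmem := GridDiagram.trivialDiagram_mem_diagramsOfType hq I
  refine ⟨GridDiagram.trivialDiagram q I, hmem, AmbientIsotopic.refl _,
    Set.mem_image_of_mem _ hmem, ?_⟩
  rintro _ ⟨E, hE, rfl⟩
  exact (GridDiagram.scr_eq_of_mem_diagramsOfType hq hmem hE).le
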